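/- Let $R$ be an associative ring with $1$ (not necessarily commutative), and assume: (a) $R$ is \emph{left Warfield}: every finitely presented left $R$-module is a direct summand of a direct sum of cyclic finitely presented left $R$-modules; (b) $R$ is \emph{right $\aleph_0$-injective}: every homomorphism of right modules $I\to R_R$ from a finitely generated right ideal $I$ of $R$ extends to a homomorphism $R_R\to R_R$; (c) $R$ is \emph{right a-coherent}: for every unary left pp formula $\phi(x)$, i.e. every formula of the form $\exists \bar y\,(A\bar y = \bar b\,x)$ with $A$ a matrix and $\bar b$ a column vector over $R$, the right ideal $I=\phi({}_RR)=\{r\in R : \exists \bar y \text{ over } R,\ A\bar y=\bar b\,r\}$ contains a finitely generated right ideal $I_0$ with the same left annihilator, $\{r : rI=0\}=\{r : rI_0=0\}$. Then $R$ is right absolutely pure, i.e. the right module $R_R$ is pure in every right $R$-module containing it (where $P\subseteq N$ is pure if every tuple of elements of $P$ that satisfies a pp formula $\exists\bar y\,(\bar y\,C=\bar x\,D)$, with $C$, $D$ matrices over $R$, in $N$ satisfies it in $P$). Hence $R$ is also left IF, i.e. every injective left $R$-module is flat. -/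

import Mathlib

universe u v w

open scoped TensorProduct DirectSum

/-! Right modules over `R` are modules over the opposite ring `Rᵐᵒᵖ`, with
`MulOpposite.op r • x` standing for `x r`. Thus right ideals of `R` are elements of
`Submodule Rᵐᵒᵖ R`. -/

namespace PPRing

/-- A positive primitive formula `∃ y, A y = B x` in `n` free variables, for left `R`-modules. -/
structure PPFormula (R : Type u) (n : ℕ) where
  numEq : ℕ
  numEx : ℕ
  A : Matrix (Fin numEq) (Fin numEx) R
  B : Matrix (Fin numEq) (Fin n) R

/-- The tuple `x` satisfies the pp formula `∃ y, A y = B x` in the module `M`. -/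
def PPFormula.Realize {R : Type u} [Ring R] {n : ℕ} (φ : PPFormula R n)
    {M : Type v} [AddCommGroup M] [Module R M] (x : Fin n → M) : Prop :=
  ∃ y : Fin φ.numEx → M, ∀ i, ∑ j, φ.A i j • y j = ∑ j, φ.B i j • x j

/-- The right ideal that a unary left pp formula defines in the left module `R`. -/
def PPFormula.rightIdeal {R : Type u} [Ring R] (φ : PPFormula R 1) : Submodule Rᵐᵒᵖ R where
  carrier := {r | φ.Realize (fun _ => r)}
  add_mem' := by
    rintro a b ⟨y, hy⟩ ⟨z, hz⟩
    refine ⟨y + z, fun i => ?_⟩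
    simp only [Pi.add_apply, smul_add, Finset.sum_add_distrib, hy i, hz i]
  zero_mem' := ⟨0, fun i => by simp⟩
  smul_mem' := by
    rintro c a ⟨y, hy⟩
    refine ⟨c • y, fun i => ?_⟩
    simp only [Pi.smul_apply, smul_comm _ c, ← Finset.smul_sum, hy i]

/-- The left annihilator of a subset of `R`. -/
def leftAnn {R : Type u} [Ring R] (S : Set R) : Set R := {r | ∀ s ∈ S, r * s = 0}

/-- `R` is right a-coherent: for every unary left pp formula `φ`, the right ideal `φ(R)` has the
same left annihilator as some finitely generated right ideal contained in it. -/
def IsRightACoherent (R : Type u) [Ring R] : Prop :=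
  ∀ φ : PPFormula R 1, ∃ I₀ : Submodule Rᵐᵒᵖ R, I₀ ≤ φ.rightIdeal ∧ I₀.FG ∧
    leftAnn (φ.rightIdeal : Set R) = leftAnn (I₀ : Set R)

/-- `R` is right `κ`-injective: every homomorphism to `R` from a right ideal with a generating set
of cardinality `< κ` extends to `R`. -/
def IsRightCardInjective (R : Type u) [Ring R] (κ : Cardinal.{u}) : Prop :=
  ∀ I : Submodule Rᵐᵒᵖ R,
    (∃ G : Set R, Cardinal.mk G < κ ∧ Submodule.span Rᵐᵒᵖ G = I) →
    ∀ f : I →ₗ[Rᵐᵒᵖ] R, ∃ g : R →ₗ[Rᵐᵒᵖ] R, ∀ x : I, g x = f x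

/-- `R` is left Warfield: every finitely presented left module is (isomorphic to) a direct summand
of a direct sum of cyclic finitely presented left modules. -/
def IsLeftWarfield (R : Type u) [Ring R] : Prop :=
  ∀ (M : Type u) [AddCommGroup M] [Module R M], Module.FinitePresentation R M →
    ∃ (ι : Type u) (C : ι → Type u) (_ : ∀ i, AddCommGroup (C i)) (_ : ∀ i, Module R (C i)),
      (∀ i, (⊤ : Submodule R (C i)).IsPrincipal ∧ Module.FinitePresentation R (C i)) ∧
      ∃ (s : M →ₗ[R] ⨁ i, C i) (p : (⨁ i, C i) →ₗ[R] M), p ∘ₗ s = LinearMap.id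

/-- A submodule `P` of `N` is pure: a tuple from `P` satisfying a pp formula in `N` satisfies it
in `P`. -/
def IsPure {R : Type u} [Ring R] {N : Type v} [AddCommGroup N] [Module R N]
    (P : Submodule R N) : Prop :=
  ∀ (n : ℕ) (φ : PPFormula R n) (x : Fin n → P),
    φ.Realize (fun i => (x i : N)) → φ.Realize x

/-- `M` is absolutely pure: it is pure in every module into which it embeds. -/
def IsAbsolutelyPure (R : Type u) [Ring R] (M : Type v) [AddCommGroup M] [Module R M] : Prop :=
  ∀ (N : Type (max v w)) [AddCommGroup N] [Module R N] (f : M →ₗ[R] N),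
    Function.Injective f → IsPure (LinearMap.range f)

/-- The relations `a r ⊗ m = a ⊗ r m` that turn `A ⊗[ℤ] M` into the tensor product over `R` of a
right module `A` and a left module `M`. -/
def tensorRel (R : Type u) [Ring R] (A : Type w) [AddCommGroup A] [Module Rᵐᵒᵖ A]
    (M : Type v) [AddCommGroup M] [Module R M] : AddSubgroup (A ⊗[ℤ] M) :=
  AddSubgroup.closure
    {t | ∃ (a : A) (r : R) (m : M), t = (MulOpposite.op r • a) ⊗ₜ[ℤ] m - a ⊗ₜ[ℤ] (r • m)}

/-- The tensor product over `R` of a right module `A` and a left module `M`, an abelian group. -/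
abbrev Tensor (R : Type u) [Ring R] (A : Type w) [AddCommGroup A] [Module Rᵐᵒᵖ A]
    (M : Type v) [AddCommGroup M] [Module R M] : Type (max v w) :=
  (A ⊗[ℤ] M) ⧸ tensorRel R A M

/-- The map `f ⊗ M : A ⊗ M → B ⊗ M` induced by a homomorphism `f : A → B` of right modules. -/
def tensorMap (R : Type u) [Ring R] {A B : Type w} [AddCommGroup A] [Module Rᵐᵒᵖ A]
    [AddCommGroup B] [Module Rᵐᵒᵖ B] (M : Type v) [AddCommGroup M] [Module R M]
    (f : A →ₗ[Rᵐᵒᵖ] B) : Tensor R A M →+ Tensor R B M :=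
  QuotientAddGroup.map (tensorRel R A M) (tensorRel R B M)
    (LinearMap.rTensor M f.toAddMonoidHom.toIntLinearMap).toAddMonoidHom (by
      rw [tensorRel, AddSubgroup.closure_le]
      rintro _ ⟨a, r, m, rfl⟩
      refine AddSubgroup.subset_closure ⟨f a, r, m, ?_⟩
      simp)

/-- The left module `M` is flat: `- ⊗ M` preserves injectivity of homomorphisms of right
modules. -/
def IsFlat (R : Type u) [Ring R] (M : Type v) [AddCommGroup M] [Module R M] : Prop :=
  ∀ (A B : Type (max u w)) [AddCommGroup A] [Module Rᵐᵒᵖ A] [AddCommGroup B] [Module Rᵐᵒᵖ B]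
    (f : A →ₗ[Rᵐᵒᵖ] B), Function.Injective f → Function.Injective (tensorMap R M f)

/-- `R` is left IF: every injective left module is flat. -/
def IsLeftIF (R : Type u) [Ring R] : Prop :=
  ∀ (M : Type (max u v)) [AddCommGroup M] [Module R M],
    Module.Injective R M → IsFlat.{u, max u v, w} R M

end PPRing

/-!
The coherence condition provides a finite set `J` that right annihilators of finite sets can be
tested on, and `ℵ₀`-injectivity turns an inclusion of annihilators on `J` into a left multiple;
together they make every finitely generated left ideal the left annihilator of a finite set. So
every cyclic finitely presented left module embeds in some `Rⁿ`, and the embedding half of the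
Warfield condition extends this to all finitely presented left modules.

Such embeddings provide enough functionals to separate a vector from a finitely generated
submodule of `Rⁿ`. A system of right linear equations that is solvable over a module containing `R`
has a right-hand side killed by the functionals that kill the coefficients, so it is solvable
in `R`.

For injective `E`, embed `Rⁿ / Rx` in `Rᵏ` and extend to `Rᵏ` the map to `E` given by a relation
`∑ xᵢ eᵢ = 0`: this factors the relation through `Rᵏ`, which is the equational criterion for the
flatness of `E`.
-/

namespace PPRing

variable {R : Type u} [Ring R]

/-! ### Annihilators of finite sets -/

/-- The right annihilator of a subset of `R`. -/
def rightAnn (S : Set R) : Set R := {x | ∀ a ∈ S, a * x = 0}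

theorem leftAnn_span (S : Set R) :
    leftAnn (Submodule.span Rᵐᵒᵖ S : Set R) = leftAnn S := by
  ext c
  exact (Submodule.span_le (p := LinearMap.ker (LinearMap.mulLeft Rᵐᵒᵖ c)) :)

/-- The unary left pp formula `⋀_{a ∈ S} a x = 0`. It has no existential variables, and its
equations are indexed by an enumeration of `S`. -/
noncomputable def annihilatorFormula (S : Finset R) : PPFormula R 1 where
  numEq := S.card
  numEx := 0
  A := 0
  B := fun i _ => (S.equivFin.symm i : R)

theorem coe_rightIdeal_annihilatorFormula (S : Finset R) :
    ((annihilatorFormula S).rightIdeal : Set R) = rightAnn (S : Set R) := by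
  ext x
  change (annihilatorFormula S).Realize (fun _ => x) ↔ _
  constructor
  · rintro ⟨y, hy⟩ a ha
    simpa [annihilatorFormula] using (hy (S.equivFin ⟨a, ha⟩)).symm
  · intro hx
    refine ⟨0, fun i => ?_⟩
    simp only [Pi.zero_apply, smul_zero, Finset.sum_const_zero]
    simpa [annihilatorFormula] using (hx _ (S.equivFin.symm i).2).symm

theorem IsRightACoherent.exists_finset_leftAnn_eq (hcoh : IsRightACoherent R)
    (S : Finset R) :
    ∃ J : Finset R, leftAnn (J : Set R) = leftAnn (rightAnn (S : Set R)) := by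
  obtain ⟨_, -, ⟨J, rfl⟩, hann⟩ := hcoh (annihilatorFormula S)
  exact ⟨J, by rw [← coe_rightIdeal_annihilatorFormula, hann, leftAnn_span]⟩

theorem IsRightCardInjective.exists_eq_mul_of_ker_le
    (hinj : IsRightCardInjective R Cardinal.aleph0)
    {P : Type*} [AddCommGroup P] [Module Rᵐᵒᵖ P] [Module.Finite Rᵐᵒᵖ P]
    (f g : P →ₗ[Rᵐᵒᵖ] R) (hker : LinearMap.ker f ≤ LinearMap.ker g) :
    ∃ b : R, ∀ x, g x = b * f x := by
  obtain ⟨G, hG⟩ : (LinearMap.range f).FG := Submodule.fg_range f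
  obtain ⟨h, hh⟩ := hinj (LinearMap.range f) ⟨G, Cardinal.lt_aleph0_of_finite _, hG⟩
    ((LinearMap.ker f).liftQ g hker ∘ₗ f.quotKerEquivRange.symm.toLinearMap)
  refine ⟨h 1, fun x => ?_⟩
  calc g x = h (f x) := by
        simpa [LinearMap.quotKerEquivRange_symm_apply_image] using
          (hh ⟨f x, LinearMap.mem_range_self f x⟩).symm
    _ = h 1 * f x := by simpa using h.map_smul (MulOpposite.op (f x)) 1

theorem span_subset_leftAnn_rightAnn (S : Set R) :
    (Ideal.span S : Set R) ⊆ leftAnn (rightAnn S) := fun _ hc x hx =>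
  (Submodule.span_le (p := LinearMap.ker (LinearMap.toSpanSingleton R R x))).2
    (fun a ha => hx a ha) hc

theorem leftAnn_rightAnn_insert (hinj : IsRightCardInjective R Cardinal.aleph0)
    {S : Set R} {J : Finset R} (hJ : leftAnn (J : Set R) = Ideal.span S) (a : R) :
    leftAnn (rightAnn (insert a S)) = Ideal.span (insert a S) := by
  refine Set.Subset.antisymm (fun c hc => ?_) (span_subset_leftAnn_rightAnn _)
  let K : Submodule Rᵐᵒᵖ R := Submodule.span Rᵐᵒᵖ (J : Set R)
  have hK : leftAnn (K : Set R) = Ideal.span S := by rw [leftAnn_span, hJ]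
  have : Module.Finite Rᵐᵒᵖ K := Module.Finite.of_fg ⟨J, rfl⟩
  have hker : LinearMap.ker ((LinearMap.mulLeft Rᵐᵒᵖ a).domRestrict K) ≤
      LinearMap.ker ((LinearMap.mulLeft Rᵐᵒᵖ c).domRestrict K) := by
    rintro ⟨x, hx⟩ hax
    refine hc x (Set.forall_mem_insert.2 ⟨hax, fun s hs => ?_⟩)
    exact (hK ▸ Ideal.subset_span hs : s ∈ leftAnn (K : Set R)) x hx
  obtain ⟨b, hb⟩ := hinj.exists_eq_mul_of_ker_le _ _ hker
  have hmem : c + -b * a ∈ leftAnn (K : Set R) := fun x hx => by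
    have hcx : c * x = b * (a * x) := hb ⟨x, hx⟩
    rw [add_mul, hcx, neg_mul, neg_mul, mul_assoc, add_neg_cancel]
  rw [hK] at hmem
  exact (Ideal.mem_span_insert' ..).2 ⟨-b, hmem⟩

theorem exists_finset_leftAnn_eq_span (hinj : IsRightCardInjective R Cardinal.aleph0)
    (hcoh : IsRightACoherent R) (S : Finset R) :
    ∃ J : Finset R, leftAnn (J : Set R) = Ideal.span (S : Set R) := by
  classical
  induction S using Finset.induction_on with
  | empty => exact ⟨{1}, by ext; simp [leftAnn]⟩
  | insert a S _ ih =>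
    obtain ⟨J, hJ⟩ := ih
    obtain ⟨J', hJ'⟩ := hcoh.exists_finset_leftAnn_eq (insert a S)
    exact ⟨J', by rw [hJ', Finset.coe_insert, leftAnn_rightAnn_insert hinj hJ]⟩

/-! ### Embeddings in free modules -/

theorem map_eq_sum_smul_single {κ M : Type*} [Fintype κ] [DecidableEq κ] [AddCommGroup M]
    [Module R M] (f : (κ → R) →ₗ[R] M) (z : κ → R) :
    f z = ∑ i, z i • f (Pi.single i 1) := by
  conv_lhs => rw [pi_eq_sum_univ' z]
  simp only [map_sum, map_smul]

section Embeddings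

variable {M : Type*} [AddCommGroup M] [Module R M]

variable (R M) in
/-- `M` embeds in some `Rⁿ`. For `M = Rᵐ / N` this provides the functionals that separate vectors
from `N`. -/
def EmbedsInFinFree : Prop :=
  ∃ (n : ℕ) (f : M →ₗ[R] (Fin n → R)), Function.Injective f

theorem EmbedsInFinFree.of_pi {ι : Type*} [Finite ι] (f : M →ₗ[R] (ι → R))
    (hf : Function.Injective f) : EmbedsInFinFree R M :=
  let e := LinearEquiv.funCongrLeft R R (Finite.equivFin ι).symm
  ⟨Nat.card ι, e.toLinearMap ∘ₗ f, e.injective.comp hf⟩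

theorem EmbedsInFinFree.of_finsupp [Module.Finite R M] {X : Type*} (f : M →ₗ[R] (X →₀ R))
    (hf : Function.Injective f) : EmbedsInFinFree R M := by
  classical
  obtain ⟨G, hG⟩ := Module.Finite.fg_top (R := R) (M := M)
  let T : Finset X := G.biUnion fun m => (f m).support
  have hT : ⊤ ≤ (Finsupp.supported R R (T : Set X)).comap f := by
    rw [← hG, Submodule.span_le]
    exact fun m hm => Finset.coe_subset.2 (Finset.subset_biUnion_of_mem (fun m => (f m).support) hm)
  refine .of_pi (ι := T) (LinearMap.pi fun x => Finsupp.lapply (x : X) ∘ₗ f) ?_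
  rw [injective_iff_map_eq_zero]
  refine fun m hm => (map_eq_zero_iff f hf).1 (Finsupp.ext fun x => ?_)
  by_cases hx : x ∈ T
  · exact congrFun hm ⟨x, hx⟩
  · exact Finsupp.notMem_support_iff.1 fun hmem => hx (hT Submodule.mem_top hmem)

theorem EmbedsInFinFree.of_directSum [Module.Finite R M] {ι : Type*} {C : ι → Type*}
    [∀ i, AddCommGroup (C i)] [∀ i, Module R (C i)] (hC : ∀ i, EmbedsInFinFree R (C i))
    (s : M →ₗ[R] ⨁ i, C i) (hs : Function.Injective s) : EmbedsInFinFree R M := by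
  classical
  choose n f hf using hC
  let b := Module.Free.chooseBasis R (⨁ i, (Fin (n i) → R))
  exact .of_finsupp (b.repr.toLinearMap ∘ₗ DirectSum.lmap f ∘ₗ s)
    (b.repr.injective.comp (((DirectSum.lmap_injective f).2 hf).comp hs))

theorem EmbedsInFinFree.of_isPrincipal (hinj : IsRightCardInjective R Cardinal.aleph0)
    (hcoh : IsRightACoherent R) [Module.FinitePresentation R M]
    (hM : (⊤ : Submodule R M).IsPrincipal) : EmbedsInFinFree R M := by
  obtain ⟨m, hm⟩ := hM
  let π := LinearMap.toSpanSingleton R M m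
  have hπ : Function.Surjective π := by
    rw [← LinearMap.range_eq_top, LinearMap.range_toSpanSingleton, hm]
  obtain ⟨S, hS⟩ := Module.FinitePresentation.fg_ker π hπ
  obtain ⟨J, hJ⟩ := exists_finset_leftAnn_eq_span hinj hcoh S
  let ρ : R →ₗ[R] (J → R) := LinearMap.pi fun x => LinearMap.toSpanSingleton R R (x : R)
  have hρ : LinearMap.ker π = LinearMap.ker ρ := by
    rw [← hS, ← SetLike.coe_set_eq]
    refine hJ.symm.trans (Set.ext fun c => ?_)
    simp [leftAnn, ρ, funext_iff]
  let f : M →ₗ[R] (J → R) := (LinearMap.ker π).liftQ ρ hρ.le ∘ₗ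
    (π.quotKerEquivOfSurjective hπ).symm.toLinearMap
  have hliftQ : Function.Injective ((LinearMap.ker π).liftQ ρ hρ.le) :=
    LinearMap.ker_eq_bot.1 (Submodule.ker_liftQ_eq_bot _ _ _ hρ.ge)
  exact .of_pi f (hliftQ.comp (LinearEquiv.injective _))

variable (R) in
/-- The Warfield condition without its splitting: every finitely presented left module embeds in a
direct sum of cyclic finitely presented left modules. -/
def EmbedsFPInCyclics : Prop :=
  ∀ (M : Type u) [AddCommGroup M] [Module R M], Module.FinitePresentation R M →
    ∃ (ι : Type u) (C : ι → Type u) (_ : ∀ i, AddCommGroup (C i)) (_ : ∀ i, Module R (C i)),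
      (∀ i, (⊤ : Submodule R (C i)).IsPrincipal ∧ Module.FinitePresentation R (C i)) ∧
      ∃ s : M →ₗ[R] ⨁ i, C i, Function.Injective s

theorem IsLeftWarfield.embedsFPInCyclics (hW : IsLeftWarfield R) : EmbedsFPInCyclics R := by
  intro M _ _ hM
  obtain ⟨ι, C, _, _, hC, s, p, hps⟩ := hW M hM
  exact ⟨ι, C, _, _, hC, s, LinearMap.injective_of_comp_eq_id s p hps⟩

theorem EmbedsInFinFree.of_finitePresentation (hW : EmbedsFPInCyclics R)
    (hinj : IsRightCardInjective R Cardinal.aleph0) (hcoh : IsRightACoherent R)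
    (M : Type u) [AddCommGroup M] [Module R M] [Module.FinitePresentation R M] :
    EmbedsInFinFree R M := by
  obtain ⟨ι, C, _, _, hC, s, hs⟩ := hW M inferInstance
  refine .of_directSum (fun i => ?_) s hs
  have := (hC i).2
  exact .of_isPrincipal hinj hcoh (hC i).1

theorem EmbedsInFinFree.quotient (hW : EmbedsFPInCyclics R)
    (hinj : IsRightCardInjective R Cardinal.aleph0) (hcoh : IsRightACoherent R)
    {n : ℕ} {N : Submodule R (Fin n → R)} (hN : N.FG) :
    EmbedsInFinFree R ((Fin n → R) ⧸ N) := by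
  have : Module.FinitePresentation R ((Fin n → R) ⧸ N) :=
    Module.finitePresentation_of_surjective N.mkQ N.mkQ_surjective (by rwa [N.ker_mkQ])
  exact .of_finitePresentation hW hinj hcoh _

end Embeddings

/-! ### Absolute purity -/

section AbsolutePurity

variable (R) in
/-- A left module is torsionless if its functionals separate its points. -/
def IsTorsionless (M : Type*) [AddCommGroup M] [Module R M] : Prop :=
  ∀ m : M, (∀ g : M →ₗ[R] R, g m = 0) → m = 0

theorem EmbedsInFinFree.isTorsionless {M : Type*} [AddCommGroup M] [Module R M]
    (hM : EmbedsInFinFree R M) : IsTorsionless R M := by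
  obtain ⟨n, f, hf⟩ := hM
  exact fun m hm => (map_eq_zero_iff f hf).1 (funext fun i => hm (LinearMap.proj i ∘ₗ f))

theorem mem_of_forall_dotProduct_eq_zero {κ : Type*} [Fintype κ] {N : Submodule R (κ → R)}
    (hN : IsTorsionless R ((κ → R) ⧸ N)) {d : κ → R}
    (hd : ∀ c : κ → R, (∀ z ∈ N, z ⬝ᵥ c = 0) → d ⬝ᵥ c = 0) : d ∈ N := by
  classical
  rw [← Submodule.Quotient.mk_eq_zero N]
  refine hN _ fun g => ?_
  have hg : ∀ z, g (Submodule.Quotient.mk z) = z ⬝ᵥ fun i => g (N.mkQ (Pi.single i 1)) :=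
    map_eq_sum_smul_single (g ∘ₗ N.mkQ)
  rw [hg]
  refine hd _ fun z hz => ?_
  rw [← hg, (Submodule.Quotient.mk_eq_zero N).2 hz, map_zero]

theorem isAbsolutelyPure_of_forall_exists_solution {S : Type u} [Ring S] {M : Type v}
    [AddCommGroup M] [Module S M]
    (h : ∀ (N : Type (max v w)) [AddCommGroup N] [Module S N] (f : M →ₗ[S] N),
      Function.Injective f → ∀ {m n : ℕ} (A : Matrix (Fin m) (Fin n) S) (d : Fin m → M)
        (y : Fin n → N), (∀ i, ∑ j, A i j • y j = f (d i)) →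
        ∃ z : Fin n → M, ∀ i, ∑ j, A i j • z j = d i) :
    IsAbsolutelyPure.{u, v, w} S M := by
  rintro N _ _ f hf n φ x ⟨y, hy⟩
  choose r hr using fun i => (x i).2
  obtain ⟨z, hz⟩ := h N f hf φ.A (fun i => ∑ j, φ.B i j • r j) y fun i => by
    simp only [hy, map_sum, map_smul, hr]
  refine ⟨fun j => ⟨f (z j), z j, rfl⟩, fun i => Subtype.ext ?_⟩
  simpa [hr] using congrArg f (hz i)

theorem dotProduct_eq_zero_of_solution {N : Type*} [AddCommGroup N] [Module Rᵐᵒᵖ N]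
    {f : R →ₗ[Rᵐᵒᵖ] N} (hf : Function.Injective f) {ι κ : Type*} [Fintype ι] [Fintype κ]
    {A : Matrix ι κ Rᵐᵒᵖ} {d c : ι → R} {y : κ → N}
    (hy : ∀ i, ∑ j, A i j • y j = f (d i))
    (hc : ∀ j, (fun i => (A i j).unop) ⬝ᵥ c = 0) : d ⬝ᵥ c = 0 := by
  refine (map_eq_zero_iff f hf).1 ?_
  calc f (d ⬝ᵥ c) = ∑ i, MulOpposite.op (c i) • f (d i) := by
        simp only [dotProduct, map_sum, ← map_smul, op_smul_eq_mul]
    _ = ∑ j, ∑ i, (MulOpposite.op (c i) * A i j) • y j := by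
        simp only [← hy, Finset.smul_sum, mul_smul]
        exact Finset.sum_comm
    _ = ∑ j, MulOpposite.op ((fun i => (A i j).unop) ⬝ᵥ c) • y j := by
        simp only [dotProduct, Finset.op_sum, Finset.sum_smul, MulOpposite.op_mul,
          MulOpposite.op_unop]
    _ = 0 := by simp only [hc, MulOpposite.op_zero, zero_smul, Finset.sum_const_zero]

theorem isAbsolutelyPure_op_of_isTorsionless
    (h : ∀ {n : ℕ} {N : Submodule R (Fin n → R)}, N.FG → IsTorsionless R ((Fin n → R) ⧸ N)) :
    IsAbsolutelyPure.{u, u, w} Rᵐᵒᵖ R := by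
  refine isAbsolutelyPure_of_forall_exists_solution fun N _ _ f hf m n A d y hy => ?_
  let column : Fin n → Fin m → R := fun j i => (A i j).unop
  have hd : d ∈ Submodule.span R (Set.range column) :=
    mem_of_forall_dotProduct_eq_zero (h (Submodule.fg_span (Set.finite_range column))) fun c hc =>
      dotProduct_eq_zero_of_solution hf hy fun j => hc _ (Submodule.subset_span ⟨j, rfl⟩)
  obtain ⟨z, hz⟩ := (Submodule.mem_span_range_iff_exists_fun R).1 hd
  refine ⟨z, fun i => ?_⟩
  simpa [column, MulOpposite.smul_eq_mul_unop] using congrFun hz i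

end AbsolutePurity

/-! ### The equational criterion for flatness -/

section EquationalCriterion

variable (R) in
/-- The equational criterion for flatness over a ring that need not be commutative: every linear
relation in `M` follows from linear relations in `R`. -/
def SatisfiesEquationalCriterion (M : Type*) [AddCommGroup M] [Module R M] : Prop :=
  ∀ {n : ℕ} (x : Fin n → R) (e : Fin n → M), ∑ i, x i • e i = 0 →
    ∃ (k : ℕ) (r : Fin n → Fin k → R) (e' : Fin k → M),
      (∀ i, e i = ∑ j, r i j • e' j) ∧ ∀ j, ∑ i, x i * r i j = 0

theorem SatisfiesEquationalCriterion.of_injective {E : Type (max u v)} [AddCommGroup E]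
    [Module R E] (hE : Module.Injective R E)
    (h : ∀ {n : ℕ} (x : Fin n → R), EmbedsInFinFree R ((Fin n → R) ⧸ Submodule.span R {x})) :
    SatisfiesEquationalCriterion R E := by
  intro n x e hxe
  let N := Submodule.span R {x}
  obtain ⟨k, s, hs⟩ := h x
  let g : ((Fin n → R) ⧸ N) →ₗ[R] E := N.liftQ (Fintype.linearCombination R e) (by
    rw [Submodule.span_le, Set.singleton_subset_iff]
    simpa [Fintype.linearCombination_apply] using hxe)
  obtain ⟨g', hg'⟩ := (Module.Baer.of_injective hE).extension_property s hs g
  refine ⟨k, fun i => s (N.mkQ (Pi.single i 1)), fun j => g' (Pi.single j 1), fun i => ?_,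
    fun j => ?_⟩
  · calc e i = g (N.mkQ (Pi.single i 1)) := by simp [g]
      _ = g' (s (N.mkQ (Pi.single i 1))) := (LinearMap.congr_fun hg' _).symm
      _ = _ := map_eq_sum_smul_single g' _
  · have hx : (s ∘ₗ N.mkQ) x = 0 := by
      rw [LinearMap.comp_apply, N.mkQ_apply,
        (Submodule.Quotient.mk_eq_zero N).2 (Submodule.mem_span_singleton_self x), map_zero]
    rw [map_eq_sum_smul_single] at hx
    simpa only [Finset.sum_apply, Pi.smul_apply, smul_eq_mul, LinearMap.comp_apply, Pi.zero_apply]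
      using congrFun hx j

theorem SatisfiesEquationalCriterion.exists_factorization {M : Type*} [AddCommGroup M]
    [Module R M] (hM : SatisfiesEquationalCriterion R M) {ι : Type*} [Fintype ι] (x : ι → R)
    (e : ι → M) (hxe : ∑ i, x i • e i = 0) :
    ∃ (k : ℕ) (r : ι → Fin k → R) (e' : Fin k → M),
      (∀ i, e i = ∑ j, r i j • e' j) ∧ ∀ j, ∑ i, x i * r i j = 0 := by
  let σ := (Fintype.equivFin ι).symm
  obtain ⟨k, r, e', he, hr⟩ := hM (x ∘ σ) (e ∘ σ) ((σ.sum_comp fun i => x i • e i).trans hxe)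
  refine ⟨k, r ∘ σ.symm, e', fun i => by simpa using he (σ.symm i), fun j => ?_⟩
  rw [← hr j, ← σ.sum_comp]
  simp only [Function.comp_apply, Equiv.symm_apply_apply]

/-- The right module structure on the character module of a left module, `(z r) e = z (r e)`. -/
noncomputable local instance characterModuleRight (E : Type*) [AddCommGroup E] [Module R E] :
    Module Rᵐᵒᵖ (CharacterModule E) :=
  inferInstanceAs (Module Rᵈᵐᵃ (E →+ AddCircle (1 : ℚ)))

theorem characterModuleRight_smul_apply {E : Type*} [AddCommGroup E] [Module R E] (r : Rᵐᵒᵖ)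
    (z : CharacterModule E) (e : E) : (r • z) e = z (r.unop • e) := rfl

theorem exists_character_comp_eq_of_ker_le {F E : Type*} [AddCommGroup F] [AddCommGroup E]
    (f : F →+ E) (c : F →+ AddCircle (1 : ℚ)) (hker : f.ker ≤ c.ker) :
    ∃ l : CharacterModule E, ∀ t, l (f t) = c t := by
  obtain ⟨l, hl⟩ := CharacterModule.dual_surjective_of_injective
    (QuotientAddGroup.kerLift f).toIntLinearMap (QuotientAddGroup.kerLift_injective f)
    (QuotientAddGroup.lift f.ker c hker)
  exact ⟨l, fun t => DFunLike.congr_fun hl (QuotientAddGroup.mk t)⟩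

variable {E : Type v} [AddCommGroup E] [Module R E]

theorem SatisfiesEquationalCriterion.sum_apply_eq_zero (hE : SatisfiesEquationalCriterion R E)
    {I : Submodule Rᵐᵒᵖ Rᵐᵒᵖ} (g : I →ₗ[Rᵐᵒᵖ] CharacterModule E) {ι : Type*} [Fintype ι]
    (x : ι → I) (e : ι → E) (hxe : ∑ i, (x i : Rᵐᵒᵖ).unop • e i = 0) : ∑ i, g (x i) (e i) = 0 := by
  obtain ⟨k, r, e', he, hr⟩ := hE.exists_factorization (fun i => (x i : Rᵐᵒᵖ).unop) e hxe
  have hx (j : Fin k) : ∑ i, MulOpposite.op (r i j) • x i = 0 :=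
    Subtype.ext (MulOpposite.unop_injective (by simpa using hr j))
  calc ∑ i, g (x i) (e i)
      = ∑ i, ∑ j, g (MulOpposite.op (r i j) • x i) (e' j) := by
        simp only [he, map_sum, map_smul, characterModuleRight_smul_apply, MulOpposite.unop_op]
    _ = ∑ j, g (∑ i, MulOpposite.op (r i j) • x i) (e' j) := by
        rw [Finset.sum_comm]
        simp only [map_sum]
        exact Finset.sum_congr rfl fun j _ => (AddMonoidHom.finsetSum_apply _ _ _).symm
    _ = 0 := by
        simp only [hx, map_zero]
        exact Finset.sum_const_zero

theorem SatisfiesEquationalCriterion.baer_characterModule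
    (hE : SatisfiesEquationalCriterion R E) : Module.Baer Rᵐᵒᵖ (CharacterModule E) := by
  classical
  intro I g
  let action : (I →₀ E) →+ E :=
    Finsupp.liftAddHom fun x => DistribSMul.toAddMonoidHom E (x : Rᵐᵒᵖ).unop
  let eval : (I →₀ E) →+ AddCircle (1 : ℚ) :=
    Finsupp.liftAddHom fun x => (g x : E →+ AddCircle (1 : ℚ))
  have hker : action.ker ≤ eval.ker := by
    intro t ht
    have hsum : ∑ x : t.support, (x : Rᵐᵒᵖ).unop • t x = 0 :=
      (Finset.sum_coe_sort t.support fun x => (x : Rᵐᵒᵖ).unop • t x).trans ht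
    exact (Finset.sum_coe_sort t.support fun x => g x (t x)).symm.trans
      (hE.sum_apply_eq_zero g (fun x : t.support => x) (fun x => t x) hsum)
  obtain ⟨l, hl⟩ := exists_character_comp_eq_of_ker_le action eval hker
  refine ⟨LinearMap.toSpanSingleton Rᵐᵒᵖ (CharacterModule E) l, fun x hx => ?_⟩
  ext e
  have haction : action (Finsupp.single ⟨x, hx⟩ e) = x.unop • e :=
    Finsupp.liftAddHom_apply_single ..
  have heval : eval (Finsupp.single ⟨x, hx⟩ e) = g ⟨x, hx⟩ e :=
    Finsupp.liftAddHom_apply_single ..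
  rw [LinearMap.toSpanSingleton_apply, characterModuleRight_smul_apply, ← haction, hl, heval]

namespace Tensor

variable {A B : Type w} [AddCommGroup A] [Module Rᵐᵒᵖ A] [AddCommGroup B] [Module Rᵐᵒᵖ B]

variable (R) in
/-- The pure tensor `a ⊗ e` in `Tensor R A E`. -/
def tmul (a : A) (e : E) : Tensor R A E := QuotientAddGroup.mk (a ⊗ₜ[ℤ] e)

theorem op_smul_tmul (r : R) (a : A) (e : E) :
    tmul R (MulOpposite.op r • a) e = tmul R a (r • e) :=
  (QuotientAddGroup.eq_iff_sub_mem).2 (AddSubgroup.subset_closure ⟨a, r, e, rfl⟩)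

theorem addHom_ext {G : Type*} [AddCommGroup G] {f g : Tensor R A E →+ G}
    (h : ∀ a e, f (tmul R a e) = g (tmul R a e)) : f = g := by
  apply QuotientAddGroup.addMonoidHom_ext
  ext t
  induction t with
  | zero => simp only [map_zero]
  | add t t' ht ht' => simp only [map_add, ht, ht']
  | tmul a e => exact h a e

/-- The right linear map `a ↦ (e ↦ c (a ⊗ e))` given by a character `c` of `A ⊗ E`. Together with
`uncurry`, this is the tensor-hom adjunction over a ring that need not be commutative. -/
noncomputable def curry (c : CharacterModule (Tensor R A E)) : A →ₗ[Rᵐᵒᵖ] CharacterModule E where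
  toFun a :=
    AddMonoidHom.mk' (fun e => c (tmul R a e)) fun e e' => by
      simp only [tmul, TensorProduct.tmul_add, QuotientAddGroup.mk_add, map_add]
  map_add' a a' := by
    ext e
    change c (tmul R (a + a') e) = c (tmul R a e) + c (tmul R a' e)
    simp only [tmul, TensorProduct.add_tmul, QuotientAddGroup.mk_add, map_add]
  map_smul' r a := by
    ext e
    exact congrArg c (op_smul_tmul r.unop a e)

/-- The character of `B ⊗ E` that a right linear map `k` from `B` to the characters of `E`
determines by `b ⊗ e ↦ k b e`. -/
noncomputable def uncurry (k : B →ₗ[Rᵐᵒᵖ] CharacterModule E) : Tensor R B E →+ AddCircle (1 : ℚ) :=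
  QuotientAddGroup.lift (tensorRel R B E)
    (TensorProduct.liftAddHom (k.toAddMonoidHom : B →+ E →+ AddCircle (1 : ℚ)) fun n b e => by
      change k (n • b) e = k b (n • e)
      rw [map_zsmul, map_zsmul]
      rfl) (by
    rw [tensorRel, AddSubgroup.closure_le]
    rintro _ ⟨b, r, e, rfl⟩
    rw [SetLike.mem_coe, AddMonoidHom.mem_ker, map_sub, sub_eq_zero]
    exact DFunLike.congr_fun (k.map_smul (MulOpposite.op r) b) e)

end Tensor

theorem isFlat_of_baer_characterModule (hE : Module.Baer Rᵐᵒᵖ (CharacterModule E)) :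
    IsFlat.{u, v, w} R E := by
  intro A B _ _ _ _ f hf
  rw [injective_iff_map_eq_zero]
  intro t ht
  by_contra hne
  obtain ⟨c, hc⟩ := CharacterModule.exists_character_apply_ne_zero_of_ne_zero hne
  obtain ⟨k, hk⟩ := hE.extension_property f hf (Tensor.curry c)
  have hkc : (Tensor.uncurry k).comp (tensorMap R E f) = c :=
    Tensor.addHom_ext fun a e => DFunLike.congr_fun (LinearMap.congr_fun hk a) e
  refine hc ((DFunLike.congr_fun hkc t).symm.trans ?_)
  rw [AddMonoidHom.comp_apply, ht, map_zero]

end EquationalCriterion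

end PPRing

theorem mainTheorem8_general {R : Type u} [Ring R]
    (hW : PPRing.EmbedsFPInCyclics R)
    (hinj : PPRing.IsRightCardInjective R Cardinal.aleph0)
    (hcoh : PPRing.IsRightACoherent R) :
    PPRing.IsAbsolutelyPure.{u, u, w} Rᵐᵒᵖ R ∧ PPRing.IsLeftIF.{u, v, w} R := by
  have hfree {n : ℕ} {N : Submodule R (Fin n → R)} (hN : N.FG) :
      PPRing.EmbedsInFinFree R ((Fin n → R) ⧸ N) := .quotient hW hinj hcoh hN
  refine ⟨PPRing.isAbsolutelyPure_op_of_isTorsionless fun hN => (hfree hN).isTorsionless,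
    fun E _ _ hE => ?_⟩
  have hcrit : PPRing.SatisfiesEquationalCriterion R E :=
    PPRing.SatisfiesEquationalCriterion.of_injective hE fun x =>
      hfree (Submodule.fg_span_singleton x)
  exact PPRing.isFlat_of_baer_characterModule hcrit.baer_characterModule

theorem mainTheorem8 {R : Type u} [Ring R]
    (hW : PPRing.IsLeftWarfield R)
    (hinj : PPRing.IsRightCardInjective R Cardinal.aleph0)
    (hcoh : PPRing.IsRightACoherent R) :
    PPRing.IsAbsolutelyPure.{u, u, w} Rᵐᵒᵖ R ∧ PPRing.IsLeftIF.{u, v, w} R :=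
  mainTheorem8_general hW.embedsFPInCyclics hinj hcoh
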